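/- Let $n\ge 0$ and $k\ge 1$, let $\Omega\subset\mathbb R^n$ be a compact convex set with non-empty interior, let $p_1,\dots,p_k\in\mathbb R^n$ be distinct points, and let $\sigma:\Omega\to\mathbb R$ be a positive continuous function. For $h\in\mathbb R^k$ put $$u_h(x)=\max_{1\le i\le k}\,(x\cdot p_i+h_i),\qquad W_i(h)=\{x\in\mathbb R^n : x\cdot p_i+h_i\ge x\cdot p_j+h_j \text{ for all } j\},$$ $$w_i(h)=\int_{W_i(h)\cap\Omega}\sigma(x)\,dx,\qquad E(h)=\int_\Omega u_h(x)\,\sigma(x)\,dx,$$ and let $$H_0=\Big\{h\in\mathbb R^k : \mathrm{vol}(W_i(h)\cap\Omega)>0 \text{ for all } i,\ \sum_{i=1}^k h_i=0\Big\},\qquad W=\Big\{A\in\mathbb R^k : A_i>0 \text{ for all } i,\ \sum_{i=1}^k A_i=\int_\Omega\sigma(x)\,dx\Big\}.$$ Then $E$ is differentiable at every $h\in H_0$ with gradient $\nabla E(h)=(w_1(h),\dots,w_k(h))$, and the map $\nabla E:H_0\to W$ sending the normalized heights $h$ to the area vector $(w_1(h),\dots,w_k(h))$ is a local $C^1$ diffeomorphism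 between these open subsets of the hyperplanes $\{\sum_i h_i=0\}$ and $\{\sum_i A_i=\int_\Omega\sigma(x)\,dx\}$: it maps $H_0$ into $W$, and every point of $H_0$ has a neighbourhood in the hyperplane $\{\sum_i h_i=0\}$, contained in $H_0$, that $\nabla E$ maps bijectively onto an open subset of $W$, with $\nabla E$ and its inverse both continuously differentiable there. -/

import Mathlib

open MeasureTheory Set

noncomputable section

namespace Alexandrov

/-- The piecewise linear convex function `u_h(x) = max_i (x · p_i + h_i)`
(a supremum over the finite, nonempty index set). -/
def potential {n k : ℕ} (p : Fin k → EuclideanSpace ℝ (Fin n))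
    (h : EuclideanSpace ℝ (Fin k)) (x : EuclideanSpace ℝ (Fin n)) : ℝ :=
  ⨆ i : Fin k, (inner ℝ x (p i) + h i)

/-- The closed convex polyhedron `W_i(h) = {x | x · p_i + h_i ≥ x · p_j + h_j for all j}`. -/
def cell {n k : ℕ} (p : Fin k → EuclideanSpace ℝ (Fin n))
    (h : EuclideanSpace ℝ (Fin k)) (i : Fin k) : Set (EuclideanSpace ℝ (Fin n)) :=
  {x | ∀ j : Fin k, inner ℝ x (p j) + h j ≤ inner ℝ x (p i) + h i}

/-- The area vector `(w_1(h), …, w_k(h))`, where `w_i(h) = ∫_{W_i(h) ∩ Ω} σ(x) dx`. -/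
def areaVector {n k : ℕ} (Ω : Set (EuclideanSpace ℝ (Fin n)))
    (σ : EuclideanSpace ℝ (Fin n) → ℝ) (p : Fin k → EuclideanSpace ℝ (Fin n))
    (h : EuclideanSpace ℝ (Fin k)) : EuclideanSpace ℝ (Fin k) :=
  WithLp.toLp 2 fun i => ∫ x in cell p h i ∩ Ω, σ x

/-- The energy `E(h) = ∫_Ω u_h(x) σ(x) dx`. -/
def energy {n k : ℕ} (Ω : Set (EuclideanSpace ℝ (Fin n)))
    (σ : EuclideanSpace ℝ (Fin n) → ℝ) (p : Fin k → EuclideanSpace ℝ (Fin n))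
    (h : EuclideanSpace ℝ (Fin k)) : ℝ :=
  ∫ x in Ω, potential p h x * σ x

/-- `H`, the set of the heights for which every cell meets `Ω` in positive volume. -/
def heights {n k : ℕ} (Ω : Set (EuclideanSpace ℝ (Fin n)))
    (p : Fin k → EuclideanSpace ℝ (Fin n)) : Set (EuclideanSpace ℝ (Fin k)) :=
  {h | ∀ i : Fin k, 0 < volume (cell p h i ∩ Ω)}

/-- The affine hyperplane of the vectors in `ℝ^k` whose coordinates have sum `c`. -/
def sumHyperplane (k : ℕ) (c : ℝ) : AffineSubspace ℝ (EuclideanSpace ℝ (Fin k)) where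
  carrier := {h | ∑ i, h i = c}
  smul_vsub_vadd_mem' := by
    intro t a b d ha hb hd
    simp only [mem_ofPred_eq] at ha hb hd ⊢
    simp [Finset.sum_add_distrib, ← Finset.mul_sum, ha, hb, hd]

/-- `H_0`, the normalized heights: those in `H` with coordinate sum `0`. -/
def normalizedHeights {n k : ℕ} (Ω : Set (EuclideanSpace ℝ (Fin n)))
    (p : Fin k → EuclideanSpace ℝ (Fin n)) : Set (EuclideanSpace ℝ (Fin k)) :=
  {h | h ∈ heights Ω p ∧ ∑ i, h i = 0}

/-- `W`, the vectors with positive coordinates and coordinate sum `∫_Ω σ(x) dx`. -/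
def areaVectors {n : ℕ} (k : ℕ) (Ω : Set (EuclideanSpace ℝ (Fin n)))
    (σ : EuclideanSpace ℝ (Fin n) → ℝ) : Set (EuclideanSpace ℝ (Fin k)) :=
  {A | (∀ i, 0 < A i) ∧ ∑ i, A i = ∫ x in Ω, σ x}

/-- `f` restricts to a `C^1` diffeomorphism from `U` onto `V`. It is used below for sets `U`, `V`
that are open in affine subspaces; there `ContDiffOn ℝ 1` is the same as being `C^1` along
the affine subspace. -/
def IsC1Diffeo {X Y : Type*} [NormedAddCommGroup X] [NormedSpace ℝ X]
    [NormedAddCommGroup Y] [NormedSpace ℝ Y] (f : X → Y) (U : Set X) (V : Set Y) : Prop :=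
  ∃ g : Y → X, MapsTo f U V ∧ MapsTo g V U ∧ InvOn g f U V ∧
    ContDiffOn ℝ 1 f U ∧ ContDiffOn ℝ 1 g V

/-- `f` is a local (`C^1`) diffeomorphism from `M`, an open subset of the affine subspace `P`, to
`N`, an open subset of the affine subspace `Q`: it maps `M` to `N`, and every point of `M` has a
neighbourhood in `P`, contained in `M`, which `f` maps `C^1`-diffeomorphically onto an open
subset of `Q` contained in `N`. -/
def IsLocalC1Diffeo {X Y : Type*} [NormedAddCommGroup X] [NormedSpace ℝ X]
    [NormedAddCommGroup Y] [NormedSpace ℝ Y] (f : X → Y)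
    (P : AffineSubspace ℝ X) (M : Set X) (Q : AffineSubspace ℝ Y) (N : Set Y) : Prop :=
  M ⊆ P ∧ N ⊆ Q ∧ MapsTo f M N ∧
    ∀ x ∈ M, ∃ (O : Set X) (O' : Set Y), IsOpen O ∧ IsOpen O' ∧ x ∈ O ∧
      (P : Set X) ∩ O ⊆ M ∧ (Q : Set Y) ∩ O' ⊆ N ∧
      IsC1Diffeo f ((P : Set X) ∩ O) ((Q : Set Y) ∩ O')

end Alexandrov

end

noncomputable section

namespace Alexandrov

open Filter Topology

/-! Let `w` denote the area vector. On the cell `W_i(h)` one has `u_h + (h'_i - h_i) ≤ u_{h'}`, so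
`w(h)` is a subgradient of `E` at `h` (`energy_add_inner_le`). A subgradient that depends
continuously on `h` is the gradient.

Smoothness of `w` comes from slicing. `W_i(h) ∩ Ω` is `Ω` cut by half-spaces whose heights are the
differences `h_i - h_l`. The derivative in one such height is an integral over a slice of `Ω`, and
this integral is continuous as long as the slice meets the interior and no two bounding hyperplanes
coincide (`contDiffOn_integral_halfSpaces`). Positive volume of all the cells guarantees both
conditions.

The matrix `∂w_i/∂h_j` behaves like a graph Laplacian: its off-diagonal entries are nonpositive, and
its rows and columns sum to zero. Connectedness of the graph is
`sum_fderiv_areaVector_indicator_pos`: raising the heights of a proper nonempty set of cells makes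
their union gain mass at a positive rate. This is proved by pushing a ball from a cell inside the
set to one outside it, with no formula for the entries. A maximum principle then shows that the
kernel is spanned by `(1, …, 1)` (`eq_of_fderiv_areaVector_eq_zero`).

Adding `(∑ h_i) • (1, …, 1)` to `w` removes this kernel. The inverse function theorem on all of
`ℝ^k` applies to the sum, which matches the two hyperplanes exactly, so its local inverse restricts
to them. -/

/-! ### Differentiability from continuous partial derivatives -/

theorem hasFDerivAt_of_continuousAt_partial {ι : Type*} [Fintype ι] [DecidableEq ι]
    {f : (ι → ℝ) → ℝ} {f' : ι → (ι → ℝ) → ℝ} {t : ι → ℝ}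
    (hf : ∀ i, ∀ᶠ s in 𝓝 t, HasDerivAt (fun a => f (Function.update s i a)) (f' i s) (s i))
    (hc : ∀ i, ContinuousAt (f' i) t) :
    HasFDerivAt f (∑ i, f' i t • ContinuousLinearMap.proj (R := ℝ) (φ := fun _ : ι => ℝ) i) t := by
  rw [hasFDerivAt_iff_isLittleO, Asymptotics.isLittleO_iff]
  intro ε hε
  set ε' : ℝ := ε / (Fintype.card ι + 1) with hε'
  have hε'pos : 0 < ε' := by positivity
  have hev : ∀ᶠ s in 𝓝 t, ∀ i, HasDerivAt (fun a => f (Function.update s i a)) (f' i s) (s i) ∧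
      ‖f' i s - f' i t‖ ≤ ε' := by
    refine eventually_all.2 fun i => (hf i).and ?_
    filter_upwards [Metric.tendsto_nhds.1 (hc i) ε' hε'pos] with s hs
    rw [← dist_eq_norm]; exact hs.le
  obtain ⟨δ, hδ, hball⟩ := Metric.eventually_nhds_iff_ball.1 hev
  filter_upwards [Metric.ball_mem_nhds t hδ] with w hw
  have hw' : ∀ i, dist (w i) (t i) < δ := (dist_pi_lt_iff hδ).1 hw
  -- Coordinates are moved from `t` to `w` one at a time. Balls of the sup norm are boxes, so every
  -- intermediate point stays in the ball, and each move is controlled by the mean value inequality.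
  have key : ∀ S : Finset ι, ‖f (S.piecewise w t) - f t - ∑ i ∈ S, f' i t * (w i - t i)‖
      ≤ ε' * S.card * ‖w - t‖ := by
    intro S
    induction S using Finset.induction_on with
    | empty => simp
    | insert i S hi ih =>
      set u := S.piecewise w t with hu
      have hui : u i = t i := by simp [hu, hi]
      have hmem : ∀ a ∈ Metric.ball (t i) δ, Function.update u i a ∈ Metric.ball t δ := by
        intro a ha
        rw [Metric.mem_ball, dist_pi_lt_iff hδ]
        intro j
        by_cases hj : j = i
        · subst hj; simpa using ha
        · rw [Function.update_of_ne hj]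
          by_cases hjS : j ∈ S
          · simpa [hu, hjS] using hw' j
          · simpa [hu, hjS] using hδ
      have hstep := Convex.norm_image_sub_le_of_norm_hasDerivWithin_le
        (f := fun a => f (Function.update u i a) - f' i t * a)
        (f' := fun a => f' i (Function.update u i a) - f' i t)
        (s := Metric.ball (t i) δ) (x := t i) (y := w i) (C := ε')
        (fun a ha => by
          have h1 := (hball _ (hmem a ha) i).1
          simp only [Function.update_idem, Function.update_self] at h1
          have h2 := h1.sub ((hasDerivAt_id' a).const_mul (f' i t))
          rw [mul_one] at h2
          exact h2.hasDerivWithinAt)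
        (fun a ha => (hball _ (hmem a ha) i).2) (convex_ball _ _)
        (Metric.mem_ball_self hδ) (hw' i)
      rw [Finset.piecewise_insert, Finset.sum_insert hi, Finset.card_insert_of_notMem hi]
      have hupd : Function.update u i (t i) = u := by rw [← hui]; exact Function.update_eq_self i u
      simp only [hupd] at hstep
      have hwi : ‖w i - t i‖ ≤ ‖w - t‖ := norm_le_pi_norm (w - t) i
      calc _ = ‖(f (Function.update u i (w i)) - f' i t * w i - (f u - f' i t * t i)) +
            (f u - f t - ∑ i ∈ S, f' i t * (w i - t i))‖ := by congr 1; ring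
        _ ≤ ε' * ‖w - t‖ + ε' * S.card * ‖w - t‖ :=
          (norm_add_le _ _).trans (add_le_add (hstep.trans (by gcongr)) ih)
        _ = _ := by push_cast; ring
  have h1 := key Finset.univ
  simp only [Finset.piecewise_univ] at h1
  have h2 : (∑ i, f' i t • ContinuousLinearMap.proj (R := ℝ) (φ := fun _ : ι => ℝ) i) (w - t) =
      ∑ i, f' i t * (w i - t i) := by simp
  rw [h2]
  refine h1.trans ?_
  gcongr
  rw [hε', div_mul_eq_mul_div, div_le_iff₀ (by positivity)]
  simp only [Finset.card_univ]
  nlinarith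

/-! ### Integration by slices parallel to a hyperplane -/

section Slice

variable {E : Type*} [NormedAddCommGroup E] [InnerProductSpace ℝ E]

/-- The decomposition of a point into its value under `⟪q, ·⟫` and its component in `qᗮ`. -/
def sliceEquiv [FiniteDimensional ℝ E] (q : E) (hq : q ≠ 0) : (ℝ × (ℝ ∙ q)ᗮ) ≃L[ℝ] E :=
  LinearEquiv.toContinuousLinearEquiv
  { toFun := fun z => (z.1 / ‖q‖ ^ 2) • q + (z.2 : E)
    map_add' := fun z w => by simp only [Prod.fst_add, Prod.snd_add, Submodule.coe_add]; module
    map_smul' := fun c z => by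
      simp only [Prod.smul_fst, Prod.smul_snd, Submodule.coe_smul, RingHom.id_apply, smul_eq_mul]
      module
    invFun := fun x => (inner ℝ q x, ⟨x - (inner ℝ q x / ‖q‖ ^ 2) • q, by
      rw [Submodule.mem_orthogonal_singleton_iff_inner_right, inner_sub_right, inner_smul_right,
        real_inner_self_eq_norm_sq]
      have : ‖q‖ ≠ 0 := norm_ne_zero_iff.2 hq
      field_simp
      ring⟩)
    left_inv := fun z => by
      have h0 : ‖q‖ ≠ 0 := norm_ne_zero_iff.2 hq
      have h1 : inner ℝ q (z.2 : E) = 0 :=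
        (Submodule.mem_orthogonal_singleton_iff_inner_right).1 z.2.2
      have h2 : inner ℝ q ((z.1 / ‖q‖ ^ 2) • q + (z.2 : E)) = z.1 := by
        rw [inner_add_right, inner_smul_right, real_inner_self_eq_norm_sq, h1]
        field_simp
        ring
      ext
      · exact h2
      · simp [h2]
    right_inv := fun x => by simp }

variable [FiniteDimensional ℝ E]

theorem sliceEquiv_apply (q : E) (hq : q ≠ 0) (z : ℝ × (ℝ ∙ q)ᗮ) :
    sliceEquiv q hq z = (z.1 / ‖q‖ ^ 2) • q + (z.2 : E) := rfl

theorem inner_sliceEquiv (q : E) (hq : q ≠ 0) (z : ℝ × (ℝ ∙ q)ᗮ) :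
    inner ℝ q (sliceEquiv q hq z) = z.1 :=
  congrArg Prod.fst ((sliceEquiv q hq).symm_apply_apply z)

theorem norm_snd_le_norm_sliceEquiv (q : E) (hq : q ≠ 0) (z : ℝ × (ℝ ∙ q)ᗮ) :
    ‖z.2‖ ≤ ‖sliceEquiv q hq z‖ := by
  have h1 : inner ℝ q (z.2 : E) = 0 :=
    (Submodule.mem_orthogonal_singleton_iff_inner_right).1 z.2.2
  have h2 := norm_add_sq_eq_norm_sq_add_norm_sq_real (x := (z.1 / ‖q‖ ^ 2) • q) (y := (z.2 : E))
    (by rw [inner_smul_left, h1, mul_zero])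
  rw [sliceEquiv_apply, Submodule.coe_norm]
  exact abs_le_of_sq_le_sq' (by nlinarith [norm_nonneg ((z.1 / ‖q‖ ^ 2) • q)]) (norm_nonneg _) |>.2

variable [MeasurableSpace E] [BorelSpace E]

/-- Uniqueness of Haar measure up to a scalar. The scalar is never computed: continuity of the slice
integrals does not depend on its value. -/
theorem exists_volume_eq_smul_map_sliceEquiv (q : E) (hq : q ≠ 0) :
    ∃ c : NNReal, (volume : Measure E) =
      c • (volume : Measure (ℝ × (ℝ ∙ q)ᗮ)).map (sliceEquiv q hq) := by
  have : (volume : Measure (ℝ × (ℝ ∙ q)ᗮ)).IsAddHaarMeasure := by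
    rw [Measure.volume_eq_prod]; infer_instance
  exact ⟨_, Measure.isAddLeftInvariant_eq_smul _ _⟩

/-- Integration over a half-space by slices parallel to its boundary. -/
theorem exists_setIntegral_halfSpace_eq (q : E) (hq : q ≠ 0) : ∃ c : ℝ,
    ∀ f : E → ℝ, Integrable f →
      Integrable (fun s : ℝ => c * ∫ y : (ℝ ∙ q)ᗮ, f (sliceEquiv q hq (s, y))) ∧
      ∀ a : ℝ, ∫ x in {x | inner ℝ q x ≤ a}, f x =
        ∫ s in Iic a, c * ∫ y : (ℝ ∙ q)ᗮ, f (sliceEquiv q hq (s, y)) := by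
  obtain ⟨c, hc⟩ := exists_volume_eq_smul_map_sliceEquiv q hq
  have hemb : MeasurableEmbedding (sliceEquiv q hq) :=
    (sliceEquiv q hq).toHomeomorph.measurableEmbedding
  refine ⟨c, fun f hf => ?_⟩
  have hint : Integrable (fun z => (c : ℝ) * f (sliceEquiv q hq z)) := by
    rw [hc] at hf
    by_cases hc0 : c = 0
    · simp [hc0]
    · have := (integrable_smul_measure (c := (c : ENNReal)) (by simpa using hc0) (by simp)).1 hf
      exact ((hemb.integrable_map_iff).1 this).const_mul _
  have hint' : Integrable (fun z => (c : ℝ) * f (sliceEquiv q hq z))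
      ((volume : Measure ℝ).prod volume) := hint
  constructor
  · have := hint'.integral_prod_left
    simpa only [integral_const_mul] using this
  · intro a
    have hpre : sliceEquiv q hq ⁻¹' {x | inner ℝ q x ≤ a} = Iic a ×ˢ univ := by
      ext z; simp [inner_sliceEquiv]
    conv_lhs => rw [hc]
    rw [Measure.restrict_smul, integral_smul_nnreal_measure, hemb.setIntegral_map, hpre,
      Measure.volume_eq_prod, NNReal.smul_def, smul_eq_mul, ← integral_const_mul,
      setIntegral_prod _ hint'.integrableOn]
    simp only [Measure.restrict_univ, integral_const_mul]

end Slice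

theorem measurable_indicator_of_continuousOn {E : Type*} [TopologicalSpace E] [MeasurableSpace E]
    [BorelSpace E] {Ω : Set E} {σ : E → ℝ} (hΩ : IsClosed Ω) (hσ : ContinuousOn σ Ω) {A : Set E}
    (hA : MeasurableSet A) : Measurable ((Ω ∩ A).indicator σ) := by
  have h : Measurable (Ω.indicator σ) := by
    classical
    rw [← piecewise_eq_indicator]
    exact hσ.measurable_piecewise continuousOn_const hΩ.measurableSet
  rw [inter_comm, ← indicator_indicator]
  exact h.indicator hA

theorem isClosed_halfSpaces {E ι : Type*} [NormedAddCommGroup E] [InnerProductSpace ℝ E]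
    (q : ι → E) (s : Set ι) (t : ι → ℝ) :
    IsClosed {x : E | ∀ l, l ∈ s → inner ℝ (q l) x ≤ t l} := by
  simp only [ofPred_forall]
  exact isClosed_iInter fun l => isClosed_iInter fun _ =>
    isClosed_le (by fun_prop) continuous_const

/-! ### Smooth dependence of integrals over cut convex bodies -/

section Polyhedral

variable {E : Type*} [NormedAddCommGroup E] [InnerProductSpace ℝ E] [FiniteDimensional ℝ E]
  [MeasurableSpace E] [BorelSpace E] {Ω : Set E} {σ : E → ℝ}

/-- If `p` is parallel to `q`, the two hyperplanes are disjoint by `h` (`p = 0` is the case `c =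
0`). Otherwise the hyperplane cuts the slice in a proper affine subspace. -/
theorem volume_slice_hyperplane_eq_zero {q p : E} (hq : q ≠ 0) {s τ : ℝ}
    (h : ∀ c : ℝ, p = c • q → τ ≠ c * s) :
    volume {y : (ℝ ∙ q)ᗮ | inner ℝ p (sliceEquiv q hq (s, y)) = τ} = 0 := by
  by_cases hp : ∀ y : (ℝ ∙ q)ᗮ, inner ℝ p (y : E) = 0
  · have hp' : p ∈ (ℝ ∙ q)ᗮᗮ := by
      rw [Submodule.mem_orthogonal']
      exact fun y hy => hp ⟨y, hy⟩
    rw [Submodule.orthogonal_orthogonal, Submodule.mem_span_singleton] at hp'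
    obtain ⟨c, rfl⟩ := hp'
    convert measure_empty (μ := (volume : Measure (ℝ ∙ q)ᗮ))
    refine eq_empty_of_forall_notMem fun y hy => h c rfl ?_
    rw [mem_ofPred_eq, inner_smul_left, inner_sliceEquiv] at hy
    simpa using hy.symm
  · push Not at hp
    obtain ⟨y₀, hy₀⟩ := hp
    let A : AffineSubspace ℝ (ℝ ∙ q)ᗮ :=
      { carrier := {y | inner ℝ p (sliceEquiv q hq (s, y)) = τ}
        smul_vsub_vadd_mem' := by
          intro r a b d ha hb hd
          simp only [mem_ofPred_eq, sliceEquiv_apply, inner_add_right, vsub_eq_sub, vadd_eq_add,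
            Submodule.coe_add, Submodule.coe_smul, Submodule.coe_sub, inner_smul_right,
            inner_sub_right] at ha hb hd ⊢
          linear_combination hd + r * ha - r * hb }
    refine Measure.addHaar_affineSubspace volume A fun hA => hy₀ ?_
    have h1 : (0 : (ℝ ∙ q)ᗮ) ∈ A := hA ▸ AffineSubspace.mem_top ℝ _ _
    have h2 : y₀ ∈ A := hA ▸ AffineSubspace.mem_top ℝ _ _
    have h1' : inner ℝ p (sliceEquiv q hq (s, 0)) = τ := h1
    have h2' : inner ℝ p (sliceEquiv q hq (s, y₀)) = τ := h2
    simp only [sliceEquiv_apply, inner_add_right, ZeroMemClass.coe_zero, inner_zero_right]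
      at h1' h2'
    linarith

/-- A segment from an interior point to a point of the closure is interior except perhaps at its far
end. Hence the sliced frontier lies in the frontier of a convex open subset of the slice, which is
null. Without the interior point the slice could contain a facet of `Ω`. -/
theorem volume_slice_frontier_eq_zero (hΩ : Convex ℝ Ω) {q : E} (hq : q ≠ 0) {s : ℝ}
    (h : ∃ x ∈ interior Ω, inner ℝ q x = s) :
    volume {y : (ℝ ∙ q)ᗮ | sliceEquiv q hq (s, y) ∈ frontier Ω} = 0 := by
  obtain ⟨x, hx, hxs⟩ := h
  obtain ⟨z, rfl⟩ := (sliceEquiv q hq).surjective x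
  rw [inner_sliceEquiv] at hxs
  set O : Set (ℝ ∙ q)ᗮ := {y | sliceEquiv q hq (s, y) ∈ interior Ω} with hO
  have hcombo : ∀ (y y' : (ℝ ∙ q)ᗮ) (a b : ℝ), a + b = 1 → sliceEquiv q hq (s, a • y + b • y') =
      a • sliceEquiv q hq (s, y) + b • sliceEquiv q hq (s, y') := by
    intro y y' a b hab
    rw [← map_smul, ← map_smul, ← map_add]
    congr 1
    ext
    · simp [← add_mul, hab]
    · simp
  have hOc : Convex ℝ O := by
    intro y hy y' hy' a b ha hb hab
    simp only [hO, mem_ofPred_eq] at hy hy' ⊢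
    rw [hcombo _ _ _ _ hab]
    exact hΩ.interior hy hy' ha hb hab
  have hOo : IsOpen O := isOpen_interior.preimage (by fun_prop)
  have hz : z.2 ∈ O := by
    simp only [hO, mem_ofPred_eq, ← hxs]; exact hx
  refine measure_mono_null (fun y hy => ?_) (hOc.addHaar_frontier volume)
  rw [hOo.frontier_eq]
  refine ⟨?_, fun hyO => hy.2 hyO⟩
  refine closure_mono (?_ : openSegment ℝ z.2 y ⊆ O)
    (segment_subset_closure_openSegment (right_mem_segment ℝ z.2 y))
  rintro _ ⟨a, b, ha, hb, hab, rfl⟩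
  simp only [hO, mem_ofPred_eq]
  rw [hcombo _ _ _ _ hab]
  exact hΩ.combo_interior_closure_mem_interior hz hy.1 ha hb.le hab

variable {ι : Type*} {q : ι → E}

/-- The integral over a slice of the weight, cut off by all the half-spaces but the `j`-th. -/
def sliceIntegral (Ω : Set E) (σ : E → ℝ) (q : ι → E) (j : ι) (hq : q j ≠ 0) (s : ℝ)
    (t : ι → ℝ) : ℝ :=
  ∫ y : (ℝ ∙ q j)ᗮ,
    (Ω ∩ {x | ∀ l, l ≠ j → inner ℝ (q l) x ≤ t l}).indicator σ (sliceEquiv (q j) hq (s, y))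

variable [Fintype ι]

/-- Dominated convergence: for fixed `y` the integrand is continuous at `(s₀, t₀)` unless `y` falls
on the frontier of `Ω` or on another bounding hyperplane, and both sets are null in the slice. -/
theorem continuousAt_sliceIntegral (hΩc : IsCompact Ω) (hΩ : Convex ℝ Ω) (hσ : ContinuousOn σ Ω)
    (j : ι) (hq : q j ≠ 0) {s₀ : ℝ} {t₀ : ι → ℝ}
    (hint : ∃ x ∈ interior Ω, inner ℝ (q j) x = s₀)
    (hne : ∀ l, l ≠ j → ∀ c : ℝ, q l = c • q j → t₀ l ≠ c * s₀) :
    ContinuousAt (fun z : ℝ × (ι → ℝ) => sliceIntegral Ω σ q j hq z.1 z.2) (s₀, t₀) := by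
  obtain ⟨M, hM⟩ := hΩc.exists_bound_of_continuousOn hσ
  obtain ⟨R, hR⟩ := hΩc.isBounded.exists_norm_le
  refine continuousAt_of_dominated
    (bound := (Metric.closedBall (0 : (ℝ ∙ q j)ᗮ) R).indicator fun _ => M) ?_ ?_ ?_ ?_
  · refine Eventually.of_forall fun z => Measurable.aestronglyMeasurable ?_
    exact (measurable_indicator_of_continuousOn hΩc.isClosed hσ
      (isClosed_halfSpaces q {l | l ≠ j} z.2).measurableSet).comp
      ((sliceEquiv (q j) hq).continuous.comp (by fun_prop)).measurable
  · refine Eventually.of_forall fun z => Eventually.of_forall fun y => ?_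
    by_cases hx : sliceEquiv (q j) hq (z.1, y) ∈
        Ω ∩ {x | ∀ l, l ≠ j → inner ℝ (q l) x ≤ z.2 l}
    · have hy : y ∈ Metric.closedBall (0 : (ℝ ∙ q j)ᗮ) R := by
        rw [mem_closedBall_zero_iff]
        exact (norm_snd_le_norm_sliceEquiv (q j) hq (z.1, y)).trans (hR _ hx.1)
      rw [indicator_of_mem hx, indicator_of_mem hy]
      exact hM _ hx.1
    · rw [indicator_of_notMem hx, norm_zero]
      by_cases hy : y ∈ Metric.closedBall (0 : (ℝ ∙ q j)ᗮ) R
      · rw [indicator_of_mem hy]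
        obtain ⟨x, hx, -⟩ := hint
        exact (norm_nonneg _).trans (hM x (interior_subset hx))
      · rw [indicator_of_notMem hy]
  · exact (integrable_indicator_iff measurableSet_closedBall).2
      (integrableOn_const (isCompact_closedBall _ _).measure_lt_top.ne)
  · have h1 : ∀ᵐ y : (ℝ ∙ q j)ᗮ, sliceEquiv (q j) hq (s₀, y) ∉ frontier Ω :=
      measure_eq_zero_iff_ae_notMem.1 (volume_slice_frontier_eq_zero hΩ hq hint)
    have h2 : ∀ᵐ y : (ℝ ∙ q j)ᗮ, ∀ l, l ≠ j →
        inner ℝ (q l) (sliceEquiv (q j) hq (s₀, y)) ≠ t₀ l := by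
      refine ae_all_iff.2 fun l => ?_
      by_cases hl : l = j
      · simp [hl]
      · filter_upwards [measure_eq_zero_iff_ae_notMem.1
          (volume_slice_hyperplane_eq_zero hq (hne l hl))] with y hy _ using hy
    filter_upwards [h1, h2] with y hy1 hy2
    have hΦ : Continuous fun z : ℝ × (ι → ℝ) => sliceEquiv (q j) hq (z.1, y) := by fun_prop
    have hin : ∀ l, Continuous fun z : ℝ × (ι → ℝ) =>
        inner ℝ (q l) (sliceEquiv (q j) hq (z.1, y)) := fun l => by fun_prop
    have hsnd : ∀ l, Continuous fun z : ℝ × (ι → ℝ) => z.2 l := fun l => by fun_prop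
    by_cases hcut : ∀ l, l ≠ j → inner ℝ (q l) (sliceEquiv (q j) hq (s₀, y)) ≤ t₀ l
    · by_cases hyΩ : sliceEquiv (q j) hq (s₀, y) ∈ Ω
      · have hyI : Ω ∈ 𝓝 (sliceEquiv (q j) hq (s₀, y)) := by
          by_contra hcon
          exact hy1 ⟨subset_closure hyΩ, fun h => hcon (mem_interior_iff_mem_nhds.1 h)⟩
        have hcont : ContinuousAt (fun z : ℝ × (ι → ℝ) => σ (sliceEquiv (q j) hq (z.1, y)))
            (s₀, t₀) :=
          ContinuousAt.comp (g := σ) (f := fun z : ℝ × (ι → ℝ) => sliceEquiv (q j) hq (z.1, y))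
            (hσ.continuousAt hyI) hΦ.continuousAt
        refine hcont.congr ?_
        have h3 : ∀ᶠ z : ℝ × (ι → ℝ) in 𝓝 (s₀, t₀), ∀ l, l ≠ j →
            inner ℝ (q l) (sliceEquiv (q j) hq (z.1, y)) ≤ z.2 l := by
          refine eventually_all.2 fun l => ?_
          by_cases hl : l = j
          · simp [hl]
          · have := ((hin l).continuousAt (x := (s₀, t₀))).eventually_lt
              (hsnd l).continuousAt
              (lt_of_le_of_ne (hcut l hl) (hy2 l hl))
            filter_upwards [this] with z hz _ using le_of_lt hz
        filter_upwards [h3, hΦ.continuousAt (x := (s₀, t₀)) |>.preimage_mem_nhds hyI] with z hz1 hz2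
        exact (indicator_of_mem (s := Ω ∩ {x | ∀ l, l ≠ j → inner ℝ (q l) x ≤ z.2 l})
          ⟨hz2, hz1⟩ σ).symm
      · refine (continuousAt_const (y := (0 : ℝ))).congr ?_
        have := hΦ.continuousAt (x := (s₀, t₀)) |>.preimage_mem_nhds (hΩc.isClosed.isOpen_compl.mem_nhds hyΩ)
        filter_upwards [this] with z hz
        rw [indicator_of_notMem fun h => hz h.1]
    · push Not at hcut
      obtain ⟨l, hl, hlt⟩ := hcut
      refine (continuousAt_const (y := (0 : ℝ))).congr ?_
      have := ((hsnd l).continuousAt (x := (s₀, t₀))).eventually_lt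
        (hin l).continuousAt hlt
      filter_upwards [this] with z hz
      rw [indicator_of_notMem fun h => (h.2 l hl).not_gt hz]

/-- The integral over a convex body cut by finitely many half-spaces is a `C^1` function of their
heights, where every bounding hyperplane meets the interior and no two of them coincide. -/
theorem contDiffOn_integral_halfSpaces (hΩc : IsCompact Ω) (hΩ : Convex ℝ Ω)
    (hσ : ContinuousOn σ Ω) (hq : ∀ j, q j ≠ 0) {U : Set (ι → ℝ)} (hU : IsOpen U)
    (hint : ∀ t ∈ U, ∀ j, ∃ x ∈ interior Ω, inner ℝ (q j) x = t j)
    (hne : ∀ t ∈ U, ∀ j l, l ≠ j → ∀ c : ℝ, q l = c • q j → t l ≠ c * t j) :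
    ContDiffOn ℝ 1 (fun t : ι → ℝ => ∫ x in Ω ∩ {x | ∀ l, inner ℝ (q l) x ≤ t l}, σ x) U := by
  classical
  choose c hc using fun j => exists_setIntegral_halfSpace_eq (q j) (hq j)
  set F : (ι → ℝ) → ℝ := fun t => ∫ x in Ω ∩ {x | ∀ l, inner ℝ (q l) x ≤ t l}, σ x with hF
  set F' : ι → (ι → ℝ) → ℝ := fun j t => c j * sliceIntegral Ω σ q j (hq j) (t j) t with hF'
  -- Joint continuity in the slice position and the heights is used twice: along `t ↦ (t j, t)` for
  -- continuity of the partial derivatives, and in the first variable alone for the fundamental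
  -- theorem of calculus.
  have hcont : ∀ t ∈ U, ∀ j, ContinuousAt (fun z : ℝ × (ι → ℝ) =>
      c j * sliceIntegral Ω σ q j (hq j) z.1 z.2) (t j, t) := fun t ht j =>
    (continuousAt_sliceIntegral hΩc hΩ hσ j (hq j) (hint t ht j)
      (hne t ht j)).const_mul _
  have hF'c : ∀ t ∈ U, ∀ j, ContinuousAt (F' j) t := fun t ht j =>
    ContinuousAt.comp (f := fun t : ι → ℝ => (t j, t)) (hcont t ht j) (by fun_prop)
  have hder : ∀ t ∈ U, ∀ j, HasDerivAt (fun a => F (Function.update t j a)) (F' j t) (t j) := by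
    intro t ht j
    set f : E → ℝ := (Ω ∩ {x | ∀ l, l ≠ j → inner ℝ (q l) x ≤ t l}).indicator σ with hf
    have hAm : MeasurableSet {x : E | ∀ l, l ≠ j → inner ℝ (q l) x ≤ t l} :=
      (isClosed_halfSpaces q {l | l ≠ j} t).measurableSet
    have hfint : Integrable f :=
      (integrable_indicator_iff (hΩc.measurableSet.inter hAm)).2
        ((hσ.integrableOn_compact hΩc).mono_set inter_subset_left)
    obtain ⟨hg, heq⟩ := hc j f hfint
    set g : ℝ → ℝ := fun s => c j * ∫ y : (ℝ ∙ q j)ᗮ, f (sliceEquiv (q j) (hq j) (s, y)) with hgdef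
    have hFg : ∀ a, F (Function.update t j a) = ∫ s in Iic a, g s := by
      intro a
      rw [← heq a, hf, setIntegral_indicator (hΩc.measurableSet.inter hAm)]
      simp only [hF]
      congr 2
      ext x
      simp only [mem_inter_iff, mem_ofPred_eq]
      constructor
      · rintro ⟨h1, h2⟩
        refine ⟨by simpa using h2 j, h1, fun l hl => by simpa [hl] using h2 l⟩
      · rintro ⟨h1, h2, h3⟩
        refine ⟨h2, fun l => ?_⟩
        by_cases hl : l = j
        · subst hl; simpa using h1
        · simpa [hl] using h3 l hl
    have hgc : ContinuousAt g (t j) :=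
      ContinuousAt.comp (f := fun s : ℝ => (s, t)) (hcont t ht j) (by fun_prop)
    have h1 : HasDerivAt (fun a => ∫ s in (t j)..a, g s) (g (t j)) (t j) :=
      intervalIntegral.integral_hasDerivAt_right (by simp)
        (hg.aestronglyMeasurable.stronglyMeasurableAtFilter) hgc
    have h2 : (fun a => F (Function.update t j a)) =
        fun a => (∫ s in (t j)..a, g s) + ∫ s in Iic (t j), g s := by
      funext a
      rw [hFg, ← intervalIntegral.integral_Iic_sub_Iic hg.integrableOn hg.integrableOn]
      ring
    rw [h2]
    exact h1.add_const _
  have hfd : ∀ t ∈ U, HasFDerivAt F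
      (∑ j, F' j t • ContinuousLinearMap.proj (R := ℝ) (φ := fun _ : ι => ℝ) j) t := fun t ht =>
    hasFDerivAt_of_continuousAt_partial
      (fun j => by filter_upwards [hU.mem_nhds ht] with s hs using hder s hs j)
      (hF'c t ht)
  intro t ht
  refine ContDiffAt.contDiffWithinAt (contDiffAt_one_iff.2 ⟨_, U, hU.mem_nhds ht, ?_, hfd⟩)
  exact continuousOn_finsetSum _ fun j _ => ContinuousOn.smul
    (fun s hs => (hF'c s hs j).continuousWithinAt) continuousOn_const

end Polyhedral

/-! ### The cells, and the gradient of the energy -/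

section Cells

variable {n k : ℕ} {Ω : Set (EuclideanSpace ℝ (Fin n))} {σ : EuclideanSpace ℝ (Fin n) → ℝ}
  {p : Fin k → EuclideanSpace ℝ (Fin n)}

theorem isClosed_cell (p : Fin k → EuclideanSpace ℝ (Fin n)) (h : EuclideanSpace ℝ (Fin k))
    (i : Fin k) : IsClosed (cell p h i) := by
  simp only [cell, ofPred_forall]
  exact isClosed_iInter fun j => isClosed_le (by fun_prop) (by fun_prop)

theorem iUnion_cell (hk : 0 < k) (p : Fin k → EuclideanSpace ℝ (Fin n))
    (h : EuclideanSpace ℝ (Fin k)) : ⋃ i, cell p h i = univ := by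
  have : Nonempty (Fin k) := ⟨⟨0, hk⟩⟩
  refine eq_univ_of_forall fun x => mem_iUnion.2 ?_
  exact Finite.exists_max fun j => inner ℝ x (p j) + h j

theorem volume_hyperplane_eq_zero {q : EuclideanSpace ℝ (Fin n)} (hq : q ≠ 0) (c : ℝ) :
    volume {x | inner ℝ x q = c} = 0 := by
  let A : AffineSubspace ℝ (EuclideanSpace ℝ (Fin n)) :=
    { carrier := {x | inner ℝ x q = c}
      smul_vsub_vadd_mem' := by
        intro r a b d ha hb hd
        simp only [mem_ofPred_eq, inner_add_left, vsub_eq_sub, vadd_eq_add, inner_smul_left,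
          inner_sub_left] at ha hb hd ⊢
        simp [ha, hb, hd] }
  refine Measure.addHaar_affineSubspace volume A fun hA => hq ?_
  have h1 : inner ℝ (0 : EuclideanSpace ℝ (Fin n)) q = c :=
    (hA ▸ AffineSubspace.mem_top ℝ _ _ : (0 : EuclideanSpace ℝ (Fin n)) ∈ A)
  have h2 : inner ℝ q q = c := (hA ▸ AffineSubspace.mem_top ℝ _ _ : q ∈ A)
  rw [inner_zero_left] at h1
  rw [← h1] at h2
  exact inner_self_eq_zero.1 h2

theorem volume_cell_inter_cell_eq_zero (hp : Function.Injective p) (h : EuclideanSpace ℝ (Fin k))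
    {i j : Fin k} (hij : i ≠ j) : volume (cell p h i ∩ cell p h j) = 0 := by
  refine measure_mono_null (fun x hx => ?_)
    (volume_hyperplane_eq_zero (sub_ne_zero.2 (hp.ne hij)) (h j - h i))
  rw [mem_ofPred_eq, inner_sub_right]
  linarith [hx.1 j, hx.2 i]

theorem sum_setIntegral_cell_finset (hp : Function.Injective p) (hΩ : IsClosed Ω)
    (h : EuclideanSpace ℝ (Fin k)) {f : EuclideanSpace ℝ (Fin n) → ℝ} (hf : IntegrableOn f Ω)
    (S : Finset (Fin k)) :
    ∑ i ∈ S, ∫ x in cell p h i ∩ Ω, f x = ∫ x in (⋃ i ∈ S, cell p h i) ∩ Ω, f x := by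
  have hU : ⋃ i : S, cell p h i ∩ Ω = (⋃ i ∈ S, cell p h i) ∩ Ω := by
    ext x
    simp
  have := hasSum_integral_iUnion_ae (μ := volume) (s := fun i : S => cell p h i ∩ Ω) (f := f)
    (fun i => ((isClosed_cell p h i).inter hΩ).measurableSet.nullMeasurableSet)
    (fun i j hij => measure_mono_null (inter_subset_inter inter_subset_left inter_subset_left)
      (volume_cell_inter_cell_eq_zero hp h (Subtype.coe_ne_coe.2 hij)))
    (by rw [hU]; exact hf.mono_set inter_subset_right)
  rw [hU] at this
  rw [← (hasSum_fintype _).unique this]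
  exact (Finset.sum_coe_sort S fun i => ∫ x in cell p h i ∩ Ω, f x).symm

theorem sum_setIntegral_cell (hk : 0 < k) (hp : Function.Injective p) (hΩ : IsClosed Ω)
    (h : EuclideanSpace ℝ (Fin k)) {f : EuclideanSpace ℝ (Fin n) → ℝ} (hf : IntegrableOn f Ω) :
    ∑ i, ∫ x in cell p h i ∩ Ω, f x = ∫ x in Ω, f x := by
  rw [sum_setIntegral_cell_finset hp hΩ h hf]
  simp [iUnion_cell hk]

/-- Without an interior point where `i` wins strictly, `W_i(h) ∩ Ω` lies in the frontier of `Ω`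
together with the ties, a null set. The strict inequalities at a point make `heights` open and
supply the witnesses used for the smoothness of the areas. -/
theorem mem_heights_iff (hΩ : Convex ℝ Ω) (hp : Function.Injective p)
    {h : EuclideanSpace ℝ (Fin k)} : h ∈ heights Ω p ↔
      ∀ i, ∃ x ∈ interior Ω, ∀ j, j ≠ i → inner ℝ x (p j) + h j < inner ℝ x (p i) + h i := by
  refine forall_congr' fun i => ⟨fun hpos => ?_, ?_⟩
  · by_contra! hcon
    refine hpos.ne' (measure_mono_null (t := frontier Ω ∪ ⋃ j : {j // j ≠ i},
      (cell p h i ∩ cell p h j)) (fun x hx => ?_) (measure_union_null (hΩ.addHaar_frontier volume)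
      (measure_iUnion_null fun j => volume_cell_inter_cell_eq_zero hp h j.2.symm)))
    by_cases hxI : x ∈ interior Ω
    · obtain ⟨j, hj, hle⟩ := hcon x hxI
      exact Or.inr (mem_iUnion.2 ⟨⟨j, hj⟩, hx.1, fun l => (hx.1 l).trans hle⟩)
    · exact Or.inl ⟨subset_closure hx.2, hxI⟩
  · rintro ⟨x, hx, hlt⟩
    have hopen : IsOpen (interior Ω ∩ {x | ∀ j, j ≠ i →
        inner ℝ x (p j) + h j < inner ℝ x (p i) + h i}) := by
      refine isOpen_interior.inter ?_
      simp only [ofPred_forall]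
      exact isOpen_iInter_of_finite fun j => isOpen_iInter_of_finite fun _ =>
        isOpen_lt (by fun_prop) (by fun_prop)
    refine (hopen.measure_pos volume ⟨x, hx, hlt⟩).trans_le (measure_mono ?_)
    rintro y ⟨hy1, hy2⟩
    refine ⟨fun j => ?_, interior_subset hy1⟩
    by_cases hj : j = i
    · rw [hj]
    · exact (hy2 j hj).le

theorem isOpen_heights (hΩ : Convex ℝ Ω) (hp : Function.Injective p) :
    IsOpen (heights Ω p) := by
  have : heights Ω p = ⋂ i, ⋃ x ∈ interior Ω, ⋂ j, ⋂ (_ : j ≠ i),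
      {h : EuclideanSpace ℝ (Fin k) | inner ℝ x (p j) + h j < inner ℝ x (p i) + h i} := by
    ext h
    rw [mem_heights_iff hΩ hp]
    simp
  rw [this]
  exact isOpen_iInter_of_finite fun i => isOpen_biUnion fun x _ => isOpen_iInter_of_finite fun j =>
    isOpen_iInter_of_finite fun _ => isOpen_lt (by fun_prop) (by fun_prop)

theorem areaVector_apply (h : EuclideanSpace ℝ (Fin k)) (i : Fin k) :
    areaVector Ω σ p h i = ∫ x in cell p h i ∩ Ω, σ x := rfl

/-- The vector of the differences `h i - h l`, `l ≠ i`. -/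
def heightDifferences (i : Fin k) : EuclideanSpace ℝ (Fin k) →L[ℝ] ({l // l ≠ i} → ℝ) :=
  ContinuousLinearMap.pi fun l => EuclideanSpace.proj i - EuclideanSpace.proj l.1

theorem heightDifferences_apply (i : Fin k) (h : EuclideanSpace ℝ (Fin k)) (l : {l // l ≠ i}) :
    heightDifferences i h l = h i - h l := rfl

theorem heightDifferences_surjective (i : Fin k) :
    Function.Surjective (heightDifferences i) := by
  intro t
  refine ⟨WithLp.toLp 2 fun l => if hl : l ≠ i then -t ⟨l, hl⟩ else 0, ?_⟩
  ext l
  simp [heightDifferences_apply, l.2]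

theorem contDiffOn_areaVector (hΩc : IsCompact Ω) (hΩ : Convex ℝ Ω) (hp : Function.Injective p)
    (hσ : ContinuousOn σ Ω) : ContDiffOn ℝ 1 (areaVector Ω σ p) (heights Ω p) := by
  rw [contDiffOn_euclidean]
  intro i
  set q : {l // l ≠ i} → EuclideanSpace ℝ (Fin n) := fun l => p l - p i with hq
  set U := heightDifferences i '' heights Ω p with hU
  have hF := contDiffOn_integral_halfSpaces (q := q) (U := U) hΩc hΩ hσ
    (fun j => sub_ne_zero.2 (hp.ne j.2))
    ((heightDifferences i).isOpenMap (heightDifferences_surjective i) _ (isOpen_heights hΩ hp))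
    -- The strict winning points of `i` and of `j` lie on opposite sides of their common hyperplane,
    -- and the interior of `Ω` is connected.
    (by
      rintro _ ⟨h, hh, rfl⟩ j
      rw [mem_heights_iff hΩ hp] at hh
      obtain ⟨x, hx, hxlt⟩ := hh i
      obtain ⟨y, hy, hylt⟩ := hh j
      have hx' := hxlt j j.2
      have hy' := hylt i j.2.symm
      refine hΩ.interior.isPreconnected.intermediate_value hx hy (f := fun x => inner ℝ (q j) x)
        (by fun_prop) ?_
      simp only [hq, heightDifferences_apply, mem_Icc, inner_sub_left]
      simp only [real_inner_comm] at hx' hy' ⊢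
      constructor <;> linarith)
    (by
      rintro _ ⟨h, hh, rfl⟩ j l hlj c hc heq
      rw [mem_heights_iff hΩ hp] at hh
      obtain ⟨x, -, hx⟩ := hh i
      obtain ⟨y, -, hy⟩ := hh j
      obtain ⟨z, -, hz⟩ := hh l
      have hlj' : l.1 ≠ j.1 := fun h => hlj (Subtype.ext h)
      have key : ∀ w : EuclideanSpace ℝ (Fin n), inner ℝ w (p l) - inner ℝ w (p i) =
          c * (inner ℝ w (p j) - inner ℝ w (p i)) := fun w => by
        rw [← inner_sub_right, ← inner_sub_right, ← inner_smul_right]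
        exact congrArg _ hc
      simp only [heightDifferences_apply] at heq
      -- Write `L_m` for the affine function of `m` minus that of `i`. Coinciding hyperplanes give
      -- `L_l = c * L_j`. The winning points of `i` and `j` force `0 < c < 1`, and then `l` never
      -- wins strictly.
      have key' : ∀ w : EuclideanSpace ℝ (Fin n),
          inner ℝ w (p l) + h l - (inner ℝ w (p i) + h i) =
          c * (inner ℝ w (p j) + h j - (inner ℝ w (p i) + h i)) := fun w => by
        linear_combination key w - heq
      have hc0 : 0 < c := by
        have h1 := hx j j.2
        have h2 := hx l l.2
        have h3 := key' x
        by_contra hcon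
        nlinarith [mul_nonneg (sub_nonneg.2 (not_lt.1 hcon)) (sub_nonneg.2 h1.le)]
      have hc1 : c < 1 := by
        have h1 := hy i j.2.symm
        have h2 := hy l hlj'
        have h3 := key' y
        by_contra hcon
        nlinarith [mul_nonneg (sub_nonneg.2 (not_lt.1 hcon)) (sub_nonneg.2 h1.le)]
      have h1 := hz i l.2.symm
      have h2 := hz j hlj'.symm
      have h3 := key' z
      rcases le_or_gt (inner ℝ z (p j) + h j - (inner ℝ z (p i) + h i)) 0 with h4 | h4
      · nlinarith [mul_nonneg hc0.le (sub_nonneg.2 h4)]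
      · nlinarith [mul_pos (sub_pos.2 hc1) h4])
  refine (hF.comp (heightDifferences i).contDiff.contDiffOn (mapsTo_image _ _)).congr fun h _ => ?_
  rw [areaVector_apply, Function.comp_apply, inter_comm]
  congr 2
  ext x
  simp only [mem_inter_iff, and_congr_right_iff, cell, mem_ofPred_eq, hq, heightDifferences_apply,
    inner_sub_left]
  refine fun _ => ⟨fun hx l => ?_, fun hx j => ?_⟩
  · have := hx l
    simp only [real_inner_comm] at this ⊢
    linarith
  · by_cases hj : j = i
    · rw [hj]
    · have := hx ⟨j, hj⟩
      simp only [real_inner_comm] at this ⊢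
      linarith

theorem potential_eq_of_mem_cell {h : EuclideanSpace ℝ (Fin k)} {i : Fin k}
    {x : EuclideanSpace ℝ (Fin n)} (hx : x ∈ cell p h i) :
    potential p h x = inner ℝ x (p i) + h i :=
  have : Nonempty (Fin k) := ⟨i⟩
  le_antisymm (ciSup_le hx) (le_ciSup (f := fun i => inner ℝ x (p i) + h i)
    (finite_range _).bddAbove i)

theorem le_potential (h : EuclideanSpace ℝ (Fin k)) (x : EuclideanSpace ℝ (Fin n)) (i : Fin k) :
    inner ℝ x (p i) + h i ≤ potential p h x :=
  le_ciSup (f := fun i => inner ℝ x (p i) + h i) (finite_range _).bddAbove i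

theorem continuous_potential (hk : 0 < k) (h : EuclideanSpace ℝ (Fin k)) :
    Continuous (potential p h) := by
  have : Nonempty (Fin k) := ⟨⟨0, hk⟩⟩
  have : potential p h = Finset.univ.sup' Finset.univ_nonempty
      fun i => fun x => inner ℝ x (p i) + h i := by
    funext x
    rw [potential, Finset.sup'_apply, Finset.sup'_univ_eq_ciSup]
  rw [this]
  exact Continuous.finset_sup' _ fun i _ => by fun_prop

/-- The area vector is a subgradient of the energy. -/
theorem energy_add_inner_le (hk : 0 < k) (hΩc : IsCompact Ω) (hp : Function.Injective p)
    (hσ : ContinuousOn σ Ω) (hσpos : ∀ x ∈ Ω, 0 < σ x) (h h' : EuclideanSpace ℝ (Fin k)) :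
    energy Ω σ p h + inner ℝ (areaVector Ω σ p h) (h' - h) ≤ energy Ω σ p h' := by
  have hi : ∀ h, IntegrableOn (fun x => potential p h x * σ x) Ω := fun h =>
    ((continuous_potential hk h).continuousOn.mul hσ).integrableOn_compact hΩc
  have hσi : IntegrableOn σ Ω := hσ.integrableOn_compact hΩc
  simp only [energy]
  rw [← sum_setIntegral_cell hk hp hΩc.isClosed h (hi h),
    ← sum_setIntegral_cell hk hp hΩc.isClosed h (hi h'), PiLp.inner_apply, ← Finset.sum_add_distrib]
  refine Finset.sum_le_sum fun i _ => ?_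
  have hsub : cell p h i ∩ Ω ⊆ Ω := inter_subset_right
  have : inner ℝ ((areaVector Ω σ p h) i) ((h' - h) i) =
      ∫ x in cell p h i ∩ Ω, (h' i - h i) * σ x := by
    rw [integral_const_mul]
    simp [areaVector_apply]
  rw [this, ← integral_add ((hi h).mono_set hsub) ((hσi.mono_set hsub).const_mul _)]
  refine setIntegral_mono_on (((hi h).mono_set hsub).add ((hσi.mono_set hsub).const_mul _))
    ((hi h').mono_set hsub) ((isClosed_cell p h i).inter hΩc.isClosed).measurableSet fun x hx => ?_
  -- On `W_i(h)` the left side becomes `(x · p_i + h'_i) σ(x)`, and its first factor is one of the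
  -- terms of the maximum defining `u_{h'}`.
  rw [← add_mul, potential_eq_of_mem_cell hx.1]
  exact mul_le_mul_of_nonneg_right (by linarith [le_potential (p := p) h' x i])
    (hσpos x hx.2).le

/-- The subgradient inequality at `h` and at `h'` squeezes the remainder between `0` and `⟪w(h') -
w(h), h' - h⟫`, which is `o(‖h' - h‖)` by continuity of `w`. -/
theorem hasGradientAt_energy (hk : 0 < k) (hΩc : IsCompact Ω) (hΩ : Convex ℝ Ω)
    (hp : Function.Injective p) (hσ : ContinuousOn σ Ω) (hσpos : ∀ x ∈ Ω, 0 < σ x)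
    {h : EuclideanSpace ℝ (Fin k)} (hh : h ∈ heights Ω p) :
    HasGradientAt (energy Ω σ p) (areaVector Ω σ p h) h := by
  rw [hasGradientAt_iff_isLittleO, Asymptotics.isLittleO_iff]
  intro ε hε
  have hc : ContinuousAt (areaVector Ω σ p) h :=
    (contDiffOn_areaVector hΩc hΩ hp hσ).continuousOn.continuousAt
      ((isOpen_heights hΩ hp).mem_nhds hh)
  filter_upwards [Metric.tendsto_nhds.1 hc ε hε] with h' hh'
  have h1 := energy_add_inner_le hk hΩc hp hσ hσpos h h'
  have h2 := energy_add_inner_le hk hΩc hp hσ hσpos h' h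
  have h3 := real_inner_le_norm (areaVector Ω σ p h' - areaVector Ω σ p h) (h' - h)
  rw [inner_sub_left] at h3
  rw [← neg_sub h' h, inner_neg_right] at h2
  rw [Real.norm_of_nonneg (by linarith)]
  rw [dist_eq_norm] at hh'
  have h4 : ‖areaVector Ω σ p h' - areaVector Ω σ p h‖ * ‖h' - h‖ ≤ ε * ‖h' - h‖ := by gcongr
  linarith

end Cells

/-- If translation by `v` carries `B ⊆ A` off `A`, then one of `N` equal steps of this translation
carries at least the fraction `1 / N` of `B` out of `A`. -/
theorem exists_le_volume_translate_diff {E : Type*} [NormedAddCommGroup E] [NormedSpace ℝ E]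
    [MeasurableSpace E] [BorelSpace E] {μ : Measure E}
    {A B : Set E} (hB : μ B ≠ ⊤) {v : E}
    (h0 : B ⊆ A) (h1 : ∀ x ∈ B, x + v ∉ A) (N : ℕ) :
    ∃ i ≤ N, μ.real B / (N + 1) ≤ μ.real {x ∈ B | x + ((i : ℝ) / (N + 1)) • v ∈ A ∧
      x + (((i : ℝ) + 1) / (N + 1)) • v ∉ A} := by
  set P : ℕ → Set E := fun i => {x ∈ B | x + ((i : ℝ) / (N + 1)) • v ∈ A} with hP
  have hN : (0 : ℝ) < N + 1 := by positivity
  have hfin : ∀ s ⊆ B, μ s ≠ ⊤ := fun s hs => ne_top_of_le_ne_top hB (measure_mono hs)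
  have hP0 : P 0 = B := by
    ext x
    simp only [hP, mem_ofPred_eq, Nat.cast_zero, zero_div, zero_smul, add_zero]
    exact ⟨fun h => h.1, fun h => ⟨h, h0 h⟩⟩
  have hPN : P (N + 1) = ∅ := by
    refine eq_empty_of_forall_notMem fun x hx => h1 x hx.1 ?_
    have := hx.2
    push_cast at this
    rwa [div_self hN.ne', one_smul] at this
  -- The right side telescopes from `μ.real B` to `0` in `N + 1` steps, so some step loses at least
  -- the average.
  have hsum : ∑ i ∈ Finset.range (N + 1), μ.real B / (N + 1) ≤
      ∑ i ∈ Finset.range (N + 1), (μ.real (P i) - μ.real (P (i + 1))) := by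
    rw [Finset.sum_range_sub', hP0, hPN, Finset.sum_const, Finset.card_range]
    simp only [measureReal_empty, sub_zero, nsmul_eq_mul]
    push_cast
    rw [mul_div_cancel₀ _ hN.ne']
  obtain ⟨i, hi, hle⟩ := Finset.exists_le_of_sum_le Finset.nonempty_range_add_one hsum
  refine ⟨i, Nat.lt_succ_iff.1 (Finset.mem_range.1 hi), hle.trans ?_⟩
  rw [sub_le_iff_le_add]
  refine (measureReal_mono (fun x hx => ?_) (measure_union_ne_top (hfin _ ?_) (hfin _ ?_))).trans
    (measureReal_union_le _ _)
  · by_cases hx' : x ∈ P (i + 1)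
    · exact Or.inr hx'
    · refine Or.inl ⟨hx.1, hx.2, fun hxA => hx' ⟨hx.1, ?_⟩⟩
      push_cast
      exact hxA
  · exact fun x hx => hx.1
  · exact fun x hx => hx.1

/-! ### The derivative of the area vector and its kernel -/

section Derivative

variable {n k : ℕ} {Ω : Set (EuclideanSpace ℝ (Fin n))} {σ : EuclideanSpace ℝ (Fin n) → ℝ}
  {p : Fin k → EuclideanSpace ℝ (Fin n)}

theorem sum_areaVector (hk : 0 < k) (hΩc : IsCompact Ω) (hp : Function.Injective p)
    (hσ : ContinuousOn σ Ω) (h : EuclideanSpace ℝ (Fin k)) :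
    ∑ i, areaVector Ω σ p h i = ∫ x in Ω, σ x :=
  sum_setIntegral_cell hk hp hΩc.isClosed h (hσ.integrableOn_compact hΩc)

theorem areaVector_pos (hΩc : IsCompact Ω) (hσ : ContinuousOn σ Ω) (hσpos : ∀ x ∈ Ω, 0 < σ x)
    {h : EuclideanSpace ℝ (Fin k)} (hh : h ∈ heights Ω p) (i : Fin k) :
    0 < areaVector Ω σ p h i := by
  have hm := ((isClosed_cell p h i).inter hΩc.isClosed).measurableSet
  rw [areaVector_apply, setIntegral_pos_iff_support_of_nonneg_ae
    ((ae_restrict_iff' hm).2 (Eventually.of_forall fun x hx => (hσpos x hx.2).le))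
    ((hσ.integrableOn_compact hΩc).mono_set inter_subset_right)]
  exact (hh i).trans_le (measure_mono fun x hx => ⟨(hσpos x hx.2).ne', hx⟩)

theorem areaVector_add_const (h : EuclideanSpace ℝ (Fin k)) (c : ℝ) :
    areaVector Ω σ p (h + c • WithLp.toLp 2 fun _ => (1 : ℝ)) = areaVector Ω σ p h := by
  ext i
  simp only [areaVector_apply]
  congr 3
  ext x
  simp [cell, ← add_assoc]

/-- Raising the height of `j` shrinks every other cell. This gives the sign of the off-diagonal
derivatives. -/
theorem areaVector_add_single_le (hΩc : IsCompact Ω) (hσ : ContinuousOn σ Ω)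
    (hσpos : ∀ x ∈ Ω, 0 < σ x) (h : EuclideanSpace ℝ (Fin k)) {i j : Fin k} (hij : i ≠ j)
    {t : ℝ} (ht : 0 ≤ t) :
    areaVector Ω σ p (h + t • EuclideanSpace.single j (1 : ℝ)) i ≤ areaVector Ω σ p h i := by
  have hm := ((isClosed_cell p h i).inter hΩc.isClosed).measurableSet
  refine setIntegral_mono_set ((hσ.integrableOn_compact hΩc).mono_set inter_subset_right)
    ((ae_restrict_iff' hm).2 (Eventually.of_forall fun x hx => (hσpos x hx.2).le))
    (LE.le.eventuallyLE (inter_subset_inter_left _ fun x hx l => ?_))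
  have h1 := hx l
  simp only [PiLp.add_apply, PiLp.smul_apply, PiLp.single_apply, hij, if_false,
    smul_eq_mul, mul_zero, add_zero] at h1
  have h2 : 0 ≤ t * if l = j then (1 : ℝ) else 0 := mul_nonneg ht (by split_ifs <;> simp)
  linarith

theorem hasDerivAt_comp_areaVector (hΩc : IsCompact Ω) (hΩ : Convex ℝ Ω)
    (hp : Function.Injective p) (hσ : ContinuousOn σ Ω) {h : EuclideanSpace ℝ (Fin k)}
    (hh : h ∈ heights Ω p) (v : EuclideanSpace ℝ (Fin k)) (ℓ : EuclideanSpace ℝ (Fin k) →L[ℝ] ℝ) :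
    HasDerivAt (fun t : ℝ => ℓ (areaVector Ω σ p (h + t • v)))
      (ℓ (fderiv ℝ (areaVector Ω σ p) h v)) 0 := by
  have h1 : HasFDerivAt (areaVector Ω σ p) (fderiv ℝ (areaVector Ω σ p) h) h :=
    (((contDiffOn_areaVector hΩc hΩ hp hσ).contDiffAt
      ((isOpen_heights hΩ hp).mem_nhds hh)).differentiableAt one_ne_zero).hasFDerivAt
  exact ℓ.hasFDerivAt.comp_hasDerivAt (0 : ℝ) (h1.hasLineDerivAt v)

/-- Going from `x` to `y` changes the gap between the affine functions of `j` and `i` by at most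
`t`, which the raise of `i` compensates. So no index outside `S` can overtake `i`. -/
theorem mem_iUnion_cell_of_near (hk : 0 < k) {h : EuclideanSpace ℝ (Fin k)}
    {S : Finset (Fin k)} {i : Fin k} (hi : i ∈ S) {x y : EuclideanSpace ℝ (Fin n)}
    (hx : x ∈ cell p h i) {t : ℝ} (ht : ∀ j, ‖y - x‖ * ‖p j - p i‖ ≤ t) :
    y ∈ ⋃ i ∈ S, cell p (h + t • WithLp.toLp 2 fun i => if i ∈ S then (1 : ℝ) else 0) i := by
  set h' := h + t • WithLp.toLp 2 fun i => if i ∈ S then (1 : ℝ) else 0 with hh'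
  obtain ⟨j, hj⟩ := mem_iUnion.1 ((iUnion_cell hk p h').symm ▸ mem_univ y)
  by_cases hjS : j ∈ S
  · exact mem_biUnion hjS hj
  · refine mem_biUnion hi fun l => (hj l).trans ?_
    have h1 := hx j
    have h2 := (real_inner_le_norm (y - x) (p j - p i)).trans (ht j)
    simp only [inner_sub_left, inner_sub_right] at h2
    simp only [hh', PiLp.add_apply, PiLp.smul_apply, hi, hjS, if_true, if_false, smul_eq_mul,
      mul_zero, mul_one, add_zero]
    linarith

/-- Raising the heights of a proper nonempty subset of the cells increases its total area at a
positive rate. -/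
theorem sum_fderiv_areaVector_indicator_pos (hΩc : IsCompact Ω) (hΩ : Convex ℝ Ω)
    (hp : Function.Injective p) (hσ : ContinuousOn σ Ω) (hσpos : ∀ x ∈ Ω, 0 < σ x)
    {h : EuclideanSpace ℝ (Fin k)} (hh : h ∈ heights Ω p) {S : Finset (Fin k)} {a b : Fin k}
    (ha : a ∈ S) (hb : b ∉ S) :
    0 < ∑ i ∈ S, fderiv ℝ (areaVector Ω σ p) h
      (WithLp.toLp 2 fun i => if i ∈ S then (1 : ℝ) else 0) i := by
  have hk : 0 < k := a.pos
  set e : EuclideanSpace ℝ (Fin k) := WithLp.toLp 2 fun i => if i ∈ S then (1 : ℝ) else 0 with he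
  set A : ℝ → Set (EuclideanSpace ℝ (Fin n)) := fun t => ⋃ i ∈ S, cell p (h + t • e) i with hA
  have hAc : ∀ t, IsClosed (A t) := fun t =>
    isClosed_biUnion_finset fun i _ => isClosed_cell p _ i
  have hA0 : A 0 = ⋃ i ∈ S, cell p h i := by simp [hA]
  obtain ⟨x, hx, hxa⟩ := (mem_heights_iff hΩ hp).1 hh a
  obtain ⟨y, hy, hyb⟩ := (mem_heights_iff hΩ hp).1 hh b
  have hnear : ∀ (i : Fin k) (z : EuclideanSpace ℝ (Fin n)), z ∈ interior Ω →
      (∀ j, j ≠ i → inner ℝ z (p j) + h j < inner ℝ z (p i) + h i) →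
      ∀ᶠ w in 𝓝 z, w ∈ interior Ω ∧
        ∀ j, j ≠ i → inner ℝ w (p j) + h j < inner ℝ w (p i) + h i := by
    intro i z hz hlt
    refine (isOpen_interior.eventually_mem hz).and (eventually_all.2 fun j => ?_)
    by_cases hj : j = i
    · simp [hj]
    · have h1 : Continuous fun w : EuclideanSpace ℝ (Fin n) => inner ℝ w (p j) + h j := by fun_prop
      have h2 : Continuous fun w : EuclideanSpace ℝ (Fin n) => inner ℝ w (p i) + h i := by fun_prop
      filter_upwards [(h1.continuousAt (x := z)).eventually_lt h2.continuousAt (hlt j hj)]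
        with w hw _ using hw
  obtain ⟨r₁, hr₁, hball₁⟩ := Metric.eventually_nhds_iff_ball.1 (hnear a x hx hxa)
  obtain ⟨r₂, hr₂, hball₂⟩ := Metric.eventually_nhds_iff_ball.1 (hnear b y hy hyb)
  -- `B` lies in the cell of `a`, its translate by `v` strictly inside the cell of `b`, and by
  -- convexity the motion between them stays in `Ω`.
  set B := Metric.ball x (min r₁ r₂) with hB
  set v := y - x with hv
  have hB₁ : ∀ z ∈ B, z ∈ Metric.ball x r₁ := fun z hz =>
    Metric.ball_subset_ball (min_le_left _ _) hz
  have hB₂ : ∀ z ∈ B, z + v ∈ Metric.ball y r₂ := fun z hz => by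
    have := Metric.ball_subset_ball (min_le_right r₁ r₂) hz
    rw [Metric.mem_ball, dist_eq_norm] at this ⊢
    rwa [hv, add_sub_assoc, sub_sub_cancel_left, ← sub_eq_add_neg]
  have hBA : B ⊆ A 0 := fun z hz => by
    rw [hA0]
    refine mem_biUnion ha fun j => ?_
    by_cases hj : j = a
    · rw [hj]
    · exact ((hball₁ z (hB₁ z hz)).2 j hj).le
  have hBA' : ∀ z ∈ B, z + v ∉ A 0 := fun z hz hzA => by
    rw [hA0] at hzA
    obtain ⟨i, hi, hzi⟩ := mem_iUnion₂.1 hzA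
    exact ((hball₂ _ (hB₂ z hz)).2 i fun h => hb (h ▸ hi)).not_ge (hzi b)
  have hBΩ : ∀ z ∈ B, ∀ s ∈ Icc (0 : ℝ) 1, z + s • v ∈ Ω := fun z hz s hs => by
    have h1 := interior_subset (hball₁ z (hB₁ z hz)).1
    have h2 := interior_subset (hball₂ _ (hB₂ z hz)).1
    have := hΩ.add_smul_mem h1 h2 hs
    exact this
  have hBpos : 0 < volume.real B :=
    ENNReal.toReal_pos (Metric.measure_ball_pos _ _ (lt_min hr₁ hr₂)).ne'
      measure_ball_lt_top.ne
  obtain ⟨x₀, hx₀, hmin⟩ := hΩc.exists_isMinOn ⟨x, interior_subset hx⟩ hσ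
  obtain ⟨M, hM⟩ := Finite.exists_le (fun ij : Fin k × Fin k => ‖p ij.1 - p ij.2‖)
  have hM0 : 0 ≤ M := (norm_nonneg _).trans (hM (a, a))
  -- With `t = K / (N + 1)`, one step of length `‖v‖ / (N + 1)` out of `A 0` still lands in `A t`.
  -- The summand `1` only keeps `K` positive.
  set K := ‖v‖ * M + 1 with hK
  have hKpos : 0 < K := by positivity
  set φ : ℝ → ℝ := fun t => ∑ i ∈ S, areaVector Ω σ p (h + t • e) i with hφ
  have hφA : ∀ t, φ t = ∫ x in A t ∩ Ω, σ x := fun t =>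
    sum_setIntegral_cell_finset hp hΩc.isClosed _ (hσ.integrableOn_compact hΩc) S
  have hder : HasDerivAt φ (∑ i ∈ S, fderiv ℝ (areaVector Ω σ p) h e i) 0 := by
    have := hasDerivAt_comp_areaVector hΩc hΩ hp hσ hh e
      (∑ i ∈ S, (EuclideanSpace.proj i : EuclideanSpace ℝ (Fin k) →L[ℝ] ℝ))
    simpa [hφ] using this
  -- Some step carries volume at least `vol B / (N + 1)` out of `A 0`, and all of it lands in `A t`.
  -- Weighted by the minimum `σ x₀`, this bounds the difference quotient below independently of `N`.
  have hstep : ∀ N : ℕ, σ x₀ * volume.real B / K ≤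
      (K / ((N : ℝ) + 1))⁻¹ • (φ (0 + K / ((N : ℝ) + 1)) - φ 0) := by
    intro N
    have hN : (0 : ℝ) < N + 1 := by positivity
    rw [zero_add]
    set t := K / ((N : ℝ) + 1) with ht
    have htpos : 0 < t := by positivity
    obtain ⟨i, hiN, hi⟩ := exists_le_volume_translate_diff (μ := volume)
      measure_ball_lt_top.ne hBA hBA' N
    have hiN' : (i : ℝ) ≤ N := by exact_mod_cast hiN
    have hmono : A 0 ⊆ A t := fun z hz => by
      rw [hA0] at hz
      obtain ⟨j, hj, hzj⟩ := mem_iUnion₂.1 hz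
      exact mem_iUnion_cell_of_near hk hj hzj (by simpa using fun _ => htpos.le)
    have hle : volume.real B / (N + 1) ≤ volume.real ((A t ∩ Ω) \ (A 0 ∩ Ω)) := by
      refine hi.trans ?_
      have hpre : volume.real ((fun z => z + (((i : ℝ) + 1) / (N + 1)) • v) ⁻¹'
          ((A t ∩ Ω) \ (A 0 ∩ Ω))) = volume.real ((A t ∩ Ω) \ (A 0 ∩ Ω)) := by
        simp only [Measure.real, measure_preimage_add_right]
      rw [← hpre]
      refine measureReal_mono ?_ ?_
      · rintro z ⟨hz, hz1, hz2⟩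
        have hzΩ : z + (((i : ℝ) + 1) / (N + 1)) • v ∈ Ω := hBΩ z hz _
          ⟨by positivity, (div_le_one hN).2 (by linarith)⟩
        refine ⟨⟨?_, hzΩ⟩, fun hcon => hz2 hcon.1⟩
        rw [hA0] at hz1
        obtain ⟨j, hj, hzj⟩ := mem_iUnion₂.1 hz1
        refine mem_iUnion_cell_of_near hk hj hzj fun l => ?_
        have hd : z + (((i : ℝ) + 1) / (N + 1)) • v - (z + ((i : ℝ) / (N + 1)) • v) =
            (1 / ((N : ℝ) + 1)) • v := by
          rw [add_sub_add_left_eq_sub, ← sub_smul]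
          congr 1
          ring
        rw [hd, norm_smul, Real.norm_of_nonneg (by positivity), ht, mul_assoc,
          div_mul_eq_mul_div, one_mul]
        gcongr
        have := mul_le_mul_of_nonneg_left (hM (l, j)) (norm_nonneg v)
        simp only at this
        linarith
      · rw [measure_preimage_add_right]
        exact ne_top_of_le_ne_top hΩc.measure_lt_top.ne (measure_mono fun z hz => hz.1.2)
    have hσi := hσ.integrableOn_compact (μ := volume) hΩc
    have hmeas : ∀ t, MeasurableSet (A t ∩ Ω) := fun t =>
      ((hAc t).inter hΩc.isClosed).measurableSet
    have hint : σ x₀ * volume.real ((A t ∩ Ω) \ (A 0 ∩ Ω)) ≤ φ t - φ 0 := by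
      rw [hφA, hφA, ← setIntegral_sdiff (hmeas 0) (hσi.mono_set inter_subset_right)
        (inter_subset_inter_left _ hmono), mul_comm, ← smul_eq_mul, ← setIntegral_const]
      refine setIntegral_mono_on (integrableOn_const ?_) (hσi.mono_set fun z hz => hz.1.2)
        ((hmeas t).diff (hmeas 0)) fun z hz => hmin hz.1.2
      exact ne_top_of_le_ne_top hΩc.measure_lt_top.ne (measure_mono fun z hz => hz.1.2)
    have h3 := (mul_le_mul_of_nonneg_left hle (hσpos x₀ hx₀).le).trans hint
    rw [smul_eq_mul, le_inv_mul_iff₀ htpos]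
    refine le_trans (le_of_eq ?_) h3
    rw [ht]
    field_simp
  have hlim : Tendsto (fun N : ℕ => K / ((N : ℝ) + 1)) atTop (𝓝[≠] 0) := by
    refine tendsto_nhdsWithin_iff.2 ⟨?_, Eventually.of_forall fun N => ?_⟩
    · simpa [div_eq_mul_inv] using (tendsto_one_div_add_atTop_nhds_zero_nat (𝕜 := ℝ)).const_mul K
    · exact (div_pos hKpos (by positivity)).ne'
  have hpos : 0 < σ x₀ * volume.real B / K := by
    have := hσpos x₀ hx₀
    positivity
  exact hpos.trans_le (ge_of_tendsto' ((hasDerivAt_iff_tendsto_slope_zero.1 hder).comp hlim) hstep)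

theorem fderiv_areaVector_single_nonpos (hΩc : IsCompact Ω) (hΩ : Convex ℝ Ω)
    (hp : Function.Injective p) (hσ : ContinuousOn σ Ω) (hσpos : ∀ x ∈ Ω, 0 < σ x)
    {h : EuclideanSpace ℝ (Fin k)} (hh : h ∈ heights Ω p) {i j : Fin k} (hij : i ≠ j) :
    fderiv ℝ (areaVector Ω σ p) h (EuclideanSpace.single j (1 : ℝ)) i ≤ 0 := by
  have hder := hasDerivAt_comp_areaVector hΩc hΩ hp hσ hh (EuclideanSpace.single j (1 : ℝ))
    (EuclideanSpace.proj i)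
  refine le_of_tendsto (hasDerivAt_iff_tendsto_slope_zero.1 hder |>.mono_left
    (nhdsWithin_mono (0 : ℝ) fun t (ht : t ∈ Ioi 0) => ne_of_gt ht)) ?_
  filter_upwards [self_mem_nhdsWithin] with t ht
  have ht' : (0 : ℝ) < t := ht
  have := areaVector_add_single_le (p := p) hΩc hσ hσpos h hij ht'.le
  rw [smul_eq_mul]
  refine mul_nonpos_of_nonneg_of_nonpos (inv_nonneg.2 ht'.le) ?_
  simpa using this

theorem fderiv_areaVector_const (hΩc : IsCompact Ω) (hΩ : Convex ℝ Ω)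
    (hp : Function.Injective p) (hσ : ContinuousOn σ Ω)
    {h : EuclideanSpace ℝ (Fin k)} (hh : h ∈ heights Ω p) (i : Fin k) :
    fderiv ℝ (areaVector Ω σ p) h (WithLp.toLp 2 fun _ => (1 : ℝ)) i = 0 := by
  have hder := hasDerivAt_comp_areaVector hΩc hΩ hp hσ hh (WithLp.toLp 2 fun _ => (1 : ℝ))
    (EuclideanSpace.proj i)
  simp only [areaVector_add_const] at hder
  exact hder.unique (hasDerivAt_const _ _)

theorem sum_fderiv_areaVector (hk : 0 < k) (hΩc : IsCompact Ω) (hΩ : Convex ℝ Ω)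
    (hp : Function.Injective p) (hσ : ContinuousOn σ Ω)
    {h : EuclideanSpace ℝ (Fin k)} (hh : h ∈ heights Ω p) (v : EuclideanSpace ℝ (Fin k)) :
    ∑ i, fderiv ℝ (areaVector Ω σ p) h v i = 0 := by
  have hder := hasDerivAt_comp_areaVector hΩc hΩ hp hσ hh v
    (∑ i, (EuclideanSpace.proj i : EuclideanSpace ℝ (Fin k) →L[ℝ] ℝ))
  simp only [sum_apply, PiLp.proj_apply, sum_areaVector hk hΩc hp hσ] at hder
  exact hder.unique (hasDerivAt_const _ _)

/-- The kernel of the derivative of the area vector consists of the constant vectors. -/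
theorem eq_of_fderiv_areaVector_eq_zero (hΩc : IsCompact Ω) (hΩ : Convex ℝ Ω)
    (hp : Function.Injective p) (hσ : ContinuousOn σ Ω) (hσpos : ∀ x ∈ Ω, 0 < σ x)
    {h : EuclideanSpace ℝ (Fin k)} (hh : h ∈ heights Ω p) {v : EuclideanSpace ℝ (Fin k)}
    (hv : fderiv ℝ (areaVector Ω σ p) h v = 0) (i j : Fin k) : v i = v j := by
  have : Nonempty (Fin k) := ⟨i⟩
  set D := fderiv ℝ (areaVector Ω σ p) h with hD
  set m : Fin k → Fin k → ℝ := fun i j => D (EuclideanSpace.single j (1 : ℝ)) i with hm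
  have hexp : ∀ (u : EuclideanSpace ℝ (Fin k)) (i : Fin k), D u i = ∑ j, u j * m i j := by
    intro u i
    have hu : u = ∑ j, u j • EuclideanSpace.single j (1 : ℝ) := by
      ext l; simp [Pi.single_apply]
    conv_lhs => rw [hu]
    simp [hm]
  -- Maximum principle: in a row `i` where `v` is maximal, all terms `(v j - v a) * m i j` are
  -- nonnegative with sum zero. Hence `m i j = 0` for `j ∉ S`, and raising `S` would not change the
  -- areas of its cells to first order, contradicting `hflux`.
  obtain ⟨a, ha⟩ := Finite.exists_max fun i => v i
  suffices ∀ b, v b = v a by rw [this i, this j]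
  by_contra! hcon
  obtain ⟨b, hb⟩ := hcon
  set S : Finset (Fin k) := Finset.univ.filter fun i => v i = v a with hS
  have hflux := sum_fderiv_areaVector_indicator_pos hΩc hΩ hp hσ hσpos hh (S := S) (a := a) (b := b)
    (by simp [hS]) (by simpa [hS] using hb)
  refine hflux.ne' (Finset.sum_eq_zero fun i hi => ?_)
  have hrow : ∑ j, m i j = 0 := by
    have := fderiv_areaVector_const hΩc hΩ hp hσ hh i
    rw [← hD, hexp] at this
    simpa using this
  have hvi : ∑ j, v j * m i j = 0 := by rw [← hexp, hv]; rfl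
  have hterm : ∑ j, (v j - v a) * m i j = 0 := by
    simp only [sub_mul, Finset.sum_sub_distrib, ← Finset.mul_sum, hrow, hvi, mul_zero, sub_zero]
  have hnonneg : ∀ j ∈ Finset.univ, 0 ≤ (v j - v a) * m i j := fun j _ => by
    by_cases hij : i = j
    · subst hij
      have : v i = v a := by simpa [hS] using hi
      simp [this]
    · exact mul_nonneg_of_nonpos_of_nonpos (sub_nonpos.2 (ha j))
        (fderiv_areaVector_single_nonpos hΩc hΩ hp hσ hσpos hh hij)
  have hzero := (Finset.sum_eq_zero_iff_of_nonneg hnonneg).1 hterm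
  rw [← hD, hexp, ← hrow]
  refine Finset.sum_congr rfl fun j _ => ?_
  by_cases hj : j ∈ S
  · simp [hj]
  · have hj' : v j - v a ≠ 0 := by simpa [hS, sub_eq_zero] using hj
    have := (mul_eq_zero.1 (hzero j (Finset.mem_univ j))).resolve_left hj'
    simp [this]

end Derivative

/-! ### The inverse function theorem between the two hyperplanes -/

section LocalDiffeo

variable {n k : ℕ} {Ω : Set (EuclideanSpace ℝ (Fin n))} {σ : EuclideanSpace ℝ (Fin n) → ℝ}
  {p : Fin k → EuclideanSpace ℝ (Fin n)}

/-- The sum of the coordinates, as a continuous linear functional. -/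
def coordSum (k : ℕ) : EuclideanSpace ℝ (Fin k) →L[ℝ] ℝ := ∑ i, EuclideanSpace.proj i

theorem coordSum_apply (h : EuclideanSpace ℝ (Fin k)) : coordSum k h = ∑ i, h i := by
  simp [coordSum]

/-- The area vector, corrected by a multiple of `(1, …, 1)` so that its derivative is invertible
on all of `ℝ^k`. It agrees with the area vector on the normalized heights. -/
def augmentedArea (Ω : Set (EuclideanSpace ℝ (Fin n))) (σ : EuclideanSpace ℝ (Fin n) → ℝ)
    (p : Fin k → EuclideanSpace ℝ (Fin n)) (h : EuclideanSpace ℝ (Fin k)) :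
    EuclideanSpace ℝ (Fin k) :=
  areaVector Ω σ p h + coordSum k h • WithLp.toLp 2 fun _ => (1 : ℝ)

theorem augmentedArea_eq {h : EuclideanSpace ℝ (Fin k)} (hh : h ∈ sumHyperplane k 0) :
    augmentedArea Ω σ p h = areaVector Ω σ p h := by
  have : coordSum k h = 0 := (coordSum_apply h).trans hh
  simp [augmentedArea, this]

/-- The coordinate sum of the image is `∫_Ω σ + k * ∑ h_i`. Being an equivalence, this lets the
local inverse restrict to the hyperplanes as well. -/
theorem augmentedArea_mem_iff (hk : 0 < k) (hΩc : IsCompact Ω) (hp : Function.Injective p)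
    (hσ : ContinuousOn σ Ω) (h : EuclideanSpace ℝ (Fin k)) :
    augmentedArea Ω σ p h ∈ sumHyperplane k (∫ x in Ω, σ x) ↔ h ∈ sumHyperplane k 0 := by
  change ∑ i, augmentedArea Ω σ p h i = _ ↔ ∑ i, h i = 0
  have : ∑ i, augmentedArea Ω σ p h i = (∫ x in Ω, σ x) + k * ∑ i, h i := by
    simp [augmentedArea, Finset.sum_add_distrib, sum_areaVector hk hΩc hp hσ, coordSum_apply]
  rw [this]
  simp [hk.ne']

theorem contDiffOn_augmentedArea (hΩc : IsCompact Ω) (hΩ : Convex ℝ Ω)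
    (hp : Function.Injective p) (hσ : ContinuousOn σ Ω) :
    ContDiffOn ℝ 1 (augmentedArea Ω σ p) (heights Ω p) :=
  (contDiffOn_areaVector hΩc hΩ hp hσ).add
    (((coordSum k).contDiff.smul contDiff_const).contDiffOn)

theorem exists_hasFDerivAt_augmentedArea (hk : 0 < k) (hΩc : IsCompact Ω) (hΩ : Convex ℝ Ω)
    (hp : Function.Injective p) (hσ : ContinuousOn σ Ω) (hσpos : ∀ x ∈ Ω, 0 < σ x)
    {h : EuclideanSpace ℝ (Fin k)} (hh : h ∈ heights Ω p) :
    ∃ L : EuclideanSpace ℝ (Fin k) ≃L[ℝ] EuclideanSpace ℝ (Fin k),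
      HasFDerivAt (augmentedArea Ω σ p) (L : EuclideanSpace ℝ (Fin k) →L[ℝ] _) h := by
  set D := fderiv ℝ (areaVector Ω σ p) h with hD
  have h1 : HasFDerivAt (areaVector Ω σ p) D h :=
    (((contDiffOn_areaVector hΩc hΩ hp hσ).contDiffAt
      ((isOpen_heights hΩ hp).mem_nhds hh)).differentiableAt one_ne_zero).hasFDerivAt
  set L₀ := D + (coordSum k).smulRight (WithLp.toLp 2 fun _ => (1 : ℝ)) with hL₀
  have h2 : HasFDerivAt (augmentedArea Ω σ p) L₀ h :=
    h1.add ((coordSum k).hasFDerivAt.smul_const _)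
  have hinj : Function.Injective L₀ := by
    rw [injective_iff_map_eq_zero]
    intro v hv
    have hv' : ∀ i, D v i + coordSum k v = 0 := fun i => by
      simpa [hL₀] using congrArg (fun u : EuclideanSpace ℝ (Fin k) => u i) hv
    -- Summing the coordinates kills the part from `D`, whose image has coordinate sum zero, and
    -- leaves `k * coordSum k v = 0`.
    have hsum : coordSum k v = 0 := by
      have h3 : ∑ i, (D v i + coordSum k v) = 0 := Finset.sum_eq_zero fun i _ => hv' i
      rw [Finset.sum_add_distrib, hD, sum_fderiv_areaVector hk hΩc hΩ hp hσ hh] at h3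
      simpa [hk.ne'] using h3
    have hDv : D v = 0 := by
      ext i
      simpa [hsum] using hv' i
    have hconst := eq_of_fderiv_areaVector_eq_zero hΩc hΩ hp hσ hσpos hh hDv
    ext i
    rw [coordSum_apply, Finset.sum_congr rfl fun j _ => hconst j i] at hsum
    simpa [hk.ne'] using hsum
  refine ⟨(LinearEquiv.ofInjectiveEndo (L₀ : EuclideanSpace ℝ (Fin k) →ₗ[ℝ] _)
    hinj).toContinuousLinearEquiv, ?_⟩
  exact h2.congr_fderiv (ContinuousLinearMap.ext fun v => rfl)

theorem isLocalC1Diffeo_gradient_energy (hk : 0 < k) (hΩc : IsCompact Ω) (hΩ : Convex ℝ Ω)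
    (hp : Function.Injective p) (hσ : ContinuousOn σ Ω) (hσpos : ∀ x ∈ Ω, 0 < σ x) :
    IsLocalC1Diffeo (gradient (energy Ω σ p))
      (sumHyperplane k 0) (normalizedHeights Ω p)
      (sumHyperplane k (∫ x in Ω, σ x)) (areaVectors k Ω σ) := by
  have hopen := isOpen_heights hΩ hp
  have hgrad : ∀ h ∈ heights Ω p, gradient (energy Ω σ p) h = areaVector Ω σ p h := fun h hh =>
    (hasGradientAt_energy hk hΩc hΩ hp hσ hσpos hh).gradient
  have hmaps : MapsTo (gradient (energy Ω σ p)) (normalizedHeights Ω p) (areaVectors k Ω σ) := by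
    intro h hh
    rw [hgrad h hh.1]
    exact ⟨areaVector_pos hΩc hσ hσpos hh.1, sum_areaVector hk hΩc hp hσ h⟩
  refine ⟨fun h hh => hh.2, fun A hA => hA.2, hmaps, fun x hx => ?_⟩
  have hΨ : ∀ h ∈ heights Ω p, ContDiffAt ℝ 1 (augmentedArea Ω σ p) h := fun h hh =>
    (contDiffOn_augmentedArea hΩc hΩ hp hσ).contDiffAt (hopen.mem_nhds hh)
  choose! L hL using fun h (hh : h ∈ heights Ω p) =>
    exists_hasFDerivAt_augmentedArea hk hΩc hΩ hp hσ hσpos hh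
  -- Restricting the source to `heights` makes the derivative invertible at each of its points, so
  -- the inverse is `C^1` on the whole target and not only at the image of `x`.
  set e := ((hΨ x hx.1).toOpenPartialHomeomorph _ (hL x hx.1) one_ne_zero).restrOpen
    (heights Ω p) hopen with he
  have hcoe : ∀ h, e h = augmentedArea Ω σ p h := fun h => rfl
  have hsource : ∀ h ∈ e.source, h ∈ heights Ω p := fun h hh => hh.2
  have hef : ∀ h ∈ (sumHyperplane k 0 : Set (EuclideanSpace ℝ (Fin k))) ∩ e.source,
      gradient (energy Ω σ p) h = e h := fun h hh => by
    rw [hgrad h (hsource h hh.2), hcoe, augmentedArea_eq hh.1]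
  have hsub : (sumHyperplane k 0 : Set (EuclideanSpace ℝ (Fin k))) ∩ e.source ⊆
      normalizedHeights Ω p := fun h hh => ⟨hsource h hh.2, hh.1⟩
  have hsymm : ∀ A ∈ (sumHyperplane k (∫ x in Ω, σ x) : Set (EuclideanSpace ℝ (Fin k))) ∩ e.target,
      e.symm A ∈ (sumHyperplane k 0 : Set (EuclideanSpace ℝ (Fin k))) ∩ e.source := fun A hA => by
    refine ⟨(augmentedArea_mem_iff hk hΩc hp hσ _).1 ?_, e.map_target hA.2⟩
    rw [← hcoe, e.right_inv hA.2]
    exact hA.1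
  refine ⟨e.source, e.target, e.open_source, e.open_target,
    ⟨(hΨ x hx.1).mem_toOpenPartialHomeomorph_source (hL x hx.1) one_ne_zero, hx.1⟩, hsub,
    fun A hA => ?_, e.symm, fun h hh => ?_, hsymm, ⟨fun h hh => ?_, fun A hA => ?_⟩, ?_, ?_⟩
  · rw [← e.right_inv hA.2, ← hef _ (hsymm A hA)]
    exact hmaps (hsub (hsymm A hA))
  · rw [hef h hh]
    refine ⟨?_, e.map_source hh.2⟩
    rw [hcoe]
    exact (augmentedArea_mem_iff hk hΩc hp hσ h).2 hh.1
  · rw [hef h hh, e.left_inv hh.2]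
  · rw [hef _ (hsymm A hA), e.right_inv hA.2]
  · exact ((contDiffOn_areaVector hΩc hΩ hp hσ).mono fun h hh => (hsub hh).1).congr
      fun h hh => hgrad h (hsub hh).1
  · exact fun A hA => (e.contDiffAt_symm hA.2 (hL _ (hsource _ (e.map_target hA.2)))
      (hΨ _ (hsource _ (e.map_target hA.2)))).contDiffWithinAt

end LocalDiffeo

end Alexandrov

end

theorem corollary3p2 (n k : ℕ) (hk : 0 < k)
    (Ω : Set (EuclideanSpace ℝ (Fin n)))
    (hΩc : IsCompact Ω) (hΩconv : Convex ℝ Ω) (hΩint : (interior Ω).Nonempty)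
    (p : Fin k → EuclideanSpace ℝ (Fin n)) (hp : Function.Injective p)
    (σ : EuclideanSpace ℝ (Fin n) → ℝ) (hσc : ContinuousOn σ Ω) (hσpos : ∀ x ∈ Ω, 0 < σ x) :
    (∀ h ∈ Alexandrov.normalizedHeights Ω p,
      HasGradientAt (Alexandrov.energy Ω σ p) (Alexandrov.areaVector Ω σ p h) h) ∧
    Alexandrov.IsLocalC1Diffeo (gradient (Alexandrov.energy Ω σ p))
      (Alexandrov.sumHyperplane k 0) (Alexandrov.normalizedHeights Ω p)
      (Alexandrov.sumHyperplane k (∫ x in Ω, σ x)) (Alexandrov.areaVectors k Ω σ) :=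
  ⟨fun _ hh => Alexandrov.hasGradientAt_energy hk hΩc hΩconv hp hσc hσpos hh.1,
    Alexandrov.isLocalC1Diffeo_gradient_energy hk hΩc hΩconv hp hσc hσpos⟩
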